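/- Let $\Lambda_n$ be the set of integer partitions $\lambda=(\lambda_1\ge\lambda_2\ge\dots)$ of $n\in\mathbb N=\{0,1,2,\dots\}$ (with $\lambda_i=0$ beyond the last part), let $\Lambda=\bigcup_{n\ge 0}\Lambda_n$, and let $d_\lambda$ be the number of standard Young tableaux of shape $\lambda$. For $\beta>0$ let $\mu_n^{(\beta)}$ be the $\beta$-Plancherel measure on $\Lambda_n$, $\mu_n^{(\beta)}(\lambda)=d_\lambda^\beta\big/\sum_{\tau\in\Lambda_n}d_\tau^\beta$. For $\alpha,\beta>0$ let $\nu_{\alpha,\beta}$ be the measure on $\mathbb N$ with $$\nu_{\alpha,\beta}(k)=\frac{1}{Z_{\alpha,\beta}}\,\alpha^k\sum_{\lambda\in\Lambda_k}\Big(\frac{d_\lambda}{k!}\Big)^{\beta},\qquad Z_{\alpha,\beta}=\sum_{k\ge 0}\alpha^k\sum_{\lambda\in\Lambda_k}\Big(\frac{d_\lambda}{k!}\Big)^{\beta},$$ and let $M^{(\alpha,\beta)}$ be the law on $\Lambda$ of the random partition obtained by drawing $X\sim\nu_{\alpha,\beta}$ and then $\lambda\in\Lambda_X$ from $\mu_X^{(\beta)}$.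 Theorem. For all $\alpha,\beta>0$, $M^{(\alpha,\beta)}$ is a probability measure (in particular $Z_{\alpha,\beta}<\infty$), and for every integer $i\ge 1$ the distribution of $\lambda_i$ under $M^{(\alpha,\beta)}$ is log-concave: the sequence $a_k=M^{(\alpha,\beta)}(\lambda_i=k)$, $k\in\mathbb Z$, satisfies $a_k^2\ge a_{k-1}a_{k+1}$ for all $k\in\mathbb Z$ and has no internal zeros (if $j<k<l$ and $a_j,a_l>0$ then $a_k>0$). -/

import Mathlib

open MeasureTheory
open scoped ENNReal Nat

namespace BetaPlancherel

/-- A standard Young tableau of shape `μ`: the numbers `1, …, |μ|` are placed bijectively in the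
cells of `μ` (the entry of the cell `c` is `T c + 1`), increasing along every row and down every
column. -/
def IsStandard (μ : YoungDiagram) (T : μ.cells ≃ Fin μ.card) : Prop :=
  (∀ c c' : μ.cells, c.1.1 = c'.1.1 → c.1.2 < c'.1.2 → T c < T c') ∧
  (∀ c c' : μ.cells, c.1.2 = c'.1.2 → c.1.1 < c'.1.1 → T c < T c')

/-- `d_μ`, the number of standard Young tableaux of shape `μ`. -/
noncomputable def numSYT (μ : YoungDiagram) : ℕ :=
  Nat.card {T : μ.cells ≃ Fin μ.card // IsStandard μ T}

/-- The set `Λ_n` of Young diagrams with `n` boxes (partitions of `n`); the set `Λ` of all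
partitions is the type `YoungDiagram`. -/
abbrev Partitions (n : ℕ) : Type := {μ : YoungDiagram // μ.card = n}

/-- Every set of Young diagrams is measurable. -/
instance instMeasurableSpaceYoungDiagram : MeasurableSpace YoungDiagram := ⊤

instance instDiscreteMeasurableSpaceYoungDiagram : DiscreteMeasurableSpace YoungDiagram :=
  ⟨fun _ => trivial⟩

/-- The `β`-Plancherel measure `μ_n^{(β)}` on `Λ_n` (as a measure on `Λ`): the partition `p` of `n`
has mass `d_p ^ β / ∑_{τ ⊢ n} d_τ ^ β`. -/
noncomputable def betaPlancherel (β : ℝ) (n : ℕ) : Measure YoungDiagram :=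
  Measure.sum fun p : Partitions n =>
    ((numSYT p.1 : ℝ≥0∞) ^ β / ∑' τ : Partitions n, (numSYT τ.1 : ℝ≥0∞) ^ β) •
      Measure.dirac p.1

/-- The unnormalized mass `α ^ k * ∑_{p ⊢ k} (d_p / k!) ^ β` of the mixing measure at `k`. -/
noncomputable def mixingWeight (α β : ℝ) (k : ℕ) : ℝ≥0∞ :=
  ENNReal.ofReal α ^ k * ∑' p : Partitions k, ((numSYT p.1 : ℝ≥0∞) / (k ! : ℝ≥0∞)) ^ β

/-- The normalizing constant `Z_{α,β}`. -/
noncomputable def mixingZ (α β : ℝ) : ℝ≥0∞ := ∑' k : ℕ, mixingWeight α β k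

/-- The mixing measure `ν_{α,β}` on `ℕ`. -/
noncomputable def mixing (α β : ℝ) : Measure ℕ :=
  Measure.sum fun k : ℕ => (mixingWeight α β k / mixingZ α β) • Measure.dirac k

/-- The mixture `M^{(α,β)}` on `Λ`: sample `X` from `ν_{α,β}`, then a partition of `X` from
`μ_X^{(β)}`. -/
noncomputable def mixture (α β : ℝ) : Measure YoungDiagram :=
  (mixing α β).bind (betaPlancherel β)

/-- A log-concave sequence on `ℤ`: non-negative, `a_{k-1} a_{k+1} ≤ a_k²` for all `k`, and without
internal zeros. -/
def LogConcaveSeq (a : ℤ → ℝ) : Prop :=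
  (∀ k, 0 ≤ a k) ∧ (∀ k, a (k - 1) * a (k + 1) ≤ a k ^ 2) ∧
    ∀ j k l : ℤ, j < k → k < l → a j ≠ 0 → a l ≠ 0 → a k ≠ 0

/-- A probability distribution on `ℤ` is log-concave if its mass function is. -/
def IsLogConcaveLaw (P : Measure ℤ) : Prop :=
  IsProbabilityMeasure P ∧ LogConcaveSeq fun k => P.real {k}

/-- The length `λ_i` of the `i`-th row of a Young diagram, for `i ≥ 1` (rows of `YoungDiagram` are
numbered from `0`), as an integer; it is `0` if there are fewer than `i` rows. -/
def rowLength (i : ℕ) (μ : YoungDiagram) : ℤ := (μ.rowLen (i - 1) : ℤ)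

end BetaPlancherel

/-!
# Log-concavity of the row lengths under the Poissonized `β`-Plancherel measure

Under the mixture a partition `μ` has mass proportional to `α ^ |μ| * (d_μ / |μ|!) ^ β`
(`mixture_apply`). For diagrams with at most `N` rows put `l_i = μ_i + N - 1 - i`, `0 ≤ i < N`. The
Frobenius formula says that `d_μ / |μ|!` is proportional to `∏_{i < j} (l_i - l_j) / ∏ l_i!`
(`exists_frobenius_constant`). It follows by induction from the branching rule
`d_μ = ∑ d_{μ ∖ corner}` (`numSYT_eq_sum_corners`) and the polynomial identity
`∑ l_i Δ(l - e_i) = (∑ l_i - N (N - 1) / 2) Δ(l)` for the Vandermonde product `Δ`, which is read off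
from the determinant of falling factorials (`sum_mul_det_vandermonde_update`).

In these coordinates the logarithm of the mass is a sum of concave functions of the differences
`l_i - l_j` and of the single coordinates `l_i`. Such a weight `w` on `ℤ ^ N` satisfies
`w(u) w(v - 1) ≤ w(u ⊓ v) w(u ⊔ v - 1)`, where `1` is the all-ones vector
(`shiftedWeight_mul_le`). If coordinate `r` of `u` is `k + 1` and that of `v - 1` is `k - 1`, then
coordinate `r` of both vectors on the right is `k`. Hence the four functions theorem of Ahlswede and
Daykin, on the distributive lattice `ℤ ^ N`, bounds the product of the masses of finite sets of
partitions with `λ_i = k + 1` and with `λ_i = k - 1` by a product of two masses of sets with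
`λ_i = k` (`sum_weight_mul_sum_le`). Every finite set of partitions has a common bound `N` on its
numbers of rows, so passing to suprema over finite sets yields the inequality for the whole law.

The normalizing constant is finite because a diagram with `n` cells has at most `√(2n)` corners, so
that `d_μ ≤ √(2 ^ n n!)` by the branching rule (`numSYT_sq_le`), and there are at most `2 ^ n`
partitions of `n`. There are no internal zeros since every `d_μ` is positive, so that `λ_i = k` has
positive mass for all `k ≥ 0`.
-/

namespace BetaPlancherel

/-! ### Removing a corner and the branching rule -/

/-- The Young diagram obtained from `μ` by deleting all cells weakly south-east of `c`. It is used
for corners `c`, where only `c` itself is deleted; the definition makes sense for every `c`. -/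
def removeCell (μ : YoungDiagram) (c : ℕ × ℕ) : YoungDiagram where
  cells := μ.cells.filter fun x => ¬ c ≤ x
  isLowerSet := by
    intro a b hba ha
    simp only [Finset.coe_filter, Set.mem_ofPred_eq] at ha ⊢
    exact ⟨μ.isLowerSet hba ha.1, fun h => ha.2 (h.trans hba)⟩

/-- The corners of `μ`: the cells with no cell of `μ` directly below or directly to the right. -/
def corners (μ : YoungDiagram) : Finset (ℕ × ℕ) :=
  μ.cells.filter fun c => (c.1 + 1, c.2) ∉ μ ∧ (c.1, c.2 + 1) ∉ μ

theorem mem_corners {μ : YoungDiagram} {c : ℕ × ℕ} :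
    c ∈ corners μ ↔ c ∈ μ ∧ (c.1 + 1, c.2) ∉ μ ∧ (c.1, c.2 + 1) ∉ μ := by
  simp [corners]

theorem eq_of_mem_corners_of_le {μ : YoungDiagram} {c x : ℕ × ℕ} (hc : c ∈ corners μ)
    (hx : x ∈ μ) (h : c ≤ x) : x = c := by
  obtain ⟨_, h1, h2⟩ := mem_corners.1 hc
  obtain ⟨h3, h4⟩ := h
  rcases h3.lt_or_eq with h3 | h3
  · exact absurd (μ.up_left_mem h3 h4 hx) h1
  rcases h4.lt_or_eq with h4 | h4
  · exact absurd (μ.up_left_mem h3.le h4 hx) h2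
  exact Prod.ext h3.symm h4.symm

theorem mem_removeCell {μ : YoungDiagram} {c x : ℕ × ℕ} (hc : c ∈ corners μ) :
    x ∈ removeCell μ c ↔ x ∈ μ ∧ x ≠ c := by
  change x ∈ μ.cells.filter _ ↔ _
  rw [Finset.mem_filter, YoungDiagram.mem_cells]
  refine and_congr_right fun hx => not_congr ⟨eq_of_mem_corners_of_le hc hx, fun h => h.ge⟩

theorem card_removeCell {μ : YoungDiagram} {c : ℕ × ℕ} (hc : c ∈ corners μ) :
    (removeCell μ c).card + 1 = μ.card := by
  have : (removeCell μ c).cells = μ.cells.erase c := by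
    ext x
    rw [YoungDiagram.mem_cells, mem_removeCell hc, Finset.mem_erase, YoungDiagram.mem_cells,
      and_comm]
  rw [YoungDiagram.card, this]
  exact Finset.card_erase_add_one (mem_corners.1 hc).1

/-- The standard Young tableaux of shape `μ`, with entries `0, …, |μ| - 1`, encoded as functions on
all of `ℕ × ℕ` that vanish off `μ`. -/
def tableaux (μ : YoungDiagram) : Set (ℕ × ℕ → ℕ) :=
  {f | (∀ c ∉ μ, f c = 0) ∧ (∀ c ∈ μ, f c < μ.card) ∧
    (∀ c ∈ μ, ∀ c' ∈ μ, f c = f c' → c = c') ∧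
    (∀ c ∈ μ, ∀ c' ∈ μ, c.1 = c'.1 → c.2 < c'.2 → f c < f c') ∧
    (∀ c ∈ μ, ∀ c' ∈ μ, c.2 = c'.2 → c.1 < c'.1 → f c < f c')}

theorem exists_tableaux_equiv (μ : YoungDiagram) :
    Nonempty ({T : μ.cells ≃ Fin μ.card // IsStandard μ T} ≃ tableaux μ) := by
  classical
  let F : {T : μ.cells ≃ Fin μ.card // IsStandard μ T} → tableaux μ := fun T =>
    ⟨fun c => if h : c ∈ μ then T.1 ⟨c, h⟩ else 0, by
      refine ⟨fun c hc => dif_neg hc, fun c hc => ?_, fun c hc c' hc' h => ?_,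
        fun c hc c' hc' h1 h2 => ?_, fun c hc c' hc' h1 h2 => ?_⟩
      · simp only [dif_pos hc]
        exact (T.1 ⟨c, hc⟩).2
      · simp only [dif_pos hc, dif_pos hc'] at h
        exact congrArg Subtype.val (T.1.injective (Fin.ext h))
      · simp only [dif_pos hc, dif_pos hc']
        exact T.2.1 ⟨c, hc⟩ ⟨c', hc'⟩ h1 h2
      · simp only [dif_pos hc, dif_pos hc']
        exact T.2.2 ⟨c, hc⟩ ⟨c', hc'⟩ h1 h2⟩
  refine ⟨Equiv.ofBijective F ⟨fun T T' h => ?_, fun f => ?_⟩⟩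
  · refine Subtype.ext (Equiv.ext fun c => Fin.ext ?_)
    have := congrFun (congrArg Subtype.val h) c.1
    have hc : c.1 ∈ μ := c.2
    simpa only [F, dif_pos hc] using this
  · obtain ⟨f, h0, h1, h2, h3, h4⟩ := f
    let g : μ.cells → Fin μ.card := fun c => ⟨f c.1, h1 c.1 c.2⟩
    have hg : Function.Bijective g := by
      rw [Fintype.bijective_iff_injective_and_card]
      refine ⟨fun c c' h => Subtype.ext (h2 _ c.2 _ c'.2 (congrArg Fin.val h)), by simp⟩
    refine ⟨⟨Equiv.ofBijective g hg, fun c c' => h3 _ c.2 _ c'.2, fun c c' => h4 _ c.2 _ c'.2⟩,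
      Subtype.ext (funext fun c => ?_)⟩
    by_cases hc : c ∈ μ
    · simp only [F, dif_pos hc]
      rfl
    · simp only [F, dif_neg hc]
      exact (h0 c hc).symm

theorem numSYT_eq_card_tableaux (μ : YoungDiagram) : numSYT μ = Nat.card (tableaux μ) :=
  Nat.card_congr (exists_tableaux_equiv μ).some

instance finite_tableaux (μ : YoungDiagram) : Finite (tableaux μ) :=
  Finite.of_equiv _ (exists_tableaux_equiv μ).some

/-- Putting the largest entry into a corner turns a tableau on the remaining cells into a tableau
of shape `μ`. -/
theorem update_mem_tableaux {μ : YoungDiagram} {c : ℕ × ℕ} (hc : c ∈ corners μ) {f : ℕ × ℕ → ℕ}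
    (hf : f ∈ tableaux (removeCell μ c)) :
    Function.update f c (removeCell μ c).card ∈ tableaux μ := by
  obtain ⟨h0, h1, h2, h3, h4⟩ := hf
  have hcard := card_removeCell hc
  have hcμ := (mem_corners.1 hc).1
  have key : ∀ x ∈ μ, x ≠ c → x ∈ removeCell μ c := fun x hx hxc => (mem_removeCell hc).2 ⟨hx, hxc⟩
  refine ⟨fun x hx => ?_, fun x hx => ?_, fun x hx y hy h => ?_, fun x hx y hy e h => ?_,
    fun x hx y hy e h => ?_⟩
  · have hxc : x ≠ c := fun h => hx (h ▸ hcμ)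
    rw [Function.update_of_ne hxc]
    exact h0 x fun h => hx ((mem_removeCell hc).1 h).1
  · by_cases hxc : x = c
    · rw [hxc, Function.update_self]
      omega
    · rw [Function.update_of_ne hxc]
      have := h1 x (key x hx hxc)
      omega
  · by_cases hxc : x = c <;> by_cases hyc : y = c
    · rw [hxc, hyc]
    · rw [hxc, Function.update_self, Function.update_of_ne hyc] at h
      have := h1 y (key y hy hyc)
      omega
    · rw [hyc, Function.update_self, Function.update_of_ne hxc] at h
      have := h1 x (key x hx hxc)
      omega
    · rw [Function.update_of_ne hyc, Function.update_of_ne hxc] at h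
      exact h2 x (key x hx hxc) y (key y hy hyc) h
  · have hxc : x ≠ c := by
      rintro rfl
      have := eq_of_mem_corners_of_le hc hy ⟨e.le, h.le⟩
      rw [this] at h
      exact h.false
    rw [Function.update_of_ne hxc]
    by_cases hyc : y = c
    · rw [hyc, Function.update_self]
      exact h1 x (key x hx hxc)
    · rw [Function.update_of_ne hyc]
      exact h3 x (key x hx hxc) y (key y hy hyc) e h
  · have hxc : x ≠ c := by
      rintro rfl
      have := eq_of_mem_corners_of_le hc hy ⟨h.le, e.le⟩
      rw [this] at h
      exact h.false
    rw [Function.update_of_ne hxc]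
    by_cases hyc : y = c
    · rw [hyc, Function.update_self]
      exact h1 x (key x hx hxc)
    · rw [Function.update_of_ne hyc]
      exact h4 x (key x hx hxc) y (key y hy hyc) e h

/-- In a tableau of nonempty shape the largest entry sits in a corner, and deleting it leaves a
tableau. -/
theorem exists_corner_of_mem_tableaux {μ : YoungDiagram} (hμ : μ.card ≠ 0) {f : ℕ × ℕ → ℕ}
    (hf : f ∈ tableaux μ) :
    ∃ c ∈ corners μ, ∃ g ∈ tableaux (removeCell μ c),
      Function.update g c (removeCell μ c).card = f := by
  obtain ⟨h0, h1, h2, h3, h4⟩ := hf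
  obtain ⟨c, hcμ, hfc⟩ : ∃ c ∈ μ.cells, f c = μ.card - 1 := by
    have himg : μ.cells.image f = Finset.range μ.card := by
      refine Finset.eq_of_subset_of_card_le (fun x hx => ?_) ?_
      · obtain ⟨c, hc, rfl⟩ := Finset.mem_image.1 hx
        exact Finset.mem_range.2 (h1 c hc)
      · rw [Finset.card_range, Finset.card_image_of_injOn fun x hx y hy h => h2 x hx y hy h]
    have : μ.card - 1 ∈ μ.cells.image f := by
      rw [himg, Finset.mem_range]
      omega
    simpa using this
  have hc : c ∈ corners μ := by
    refine mem_corners.2 ⟨hcμ, fun h => ?_, fun h => ?_⟩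
    · have := h4 c hcμ _ h rfl (Nat.lt_succ_self _)
      have := h1 _ h
      omega
    · have := h3 c hcμ _ h rfl (Nat.lt_succ_self _)
      have := h1 _ h
      omega
  have hcard := card_removeCell hc
  have key : ∀ x ∈ removeCell μ c, x ∈ μ ∧ x ≠ c := fun x hx => (mem_removeCell hc).1 hx
  refine ⟨c, hc, Function.update f c 0, ⟨fun x hx => ?_, fun x hx => ?_, fun x hx y hy h => ?_,
    fun x hx y hy e h => ?_, fun x hx y hy e h => ?_⟩, ?_⟩
  · by_cases hxc : x = c
    · rw [hxc, Function.update_self]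
    · rw [Function.update_of_ne hxc]
      exact h0 x fun h => hx ((mem_removeCell hc).2 ⟨h, hxc⟩)
  · rw [Function.update_of_ne (key x hx).2]
    have hlt := h1 x (key x hx).1
    have hne : f x ≠ f c := fun h => (key x hx).2 (h2 x (key x hx).1 c hcμ h)
    omega
  · rw [Function.update_of_ne (key x hx).2, Function.update_of_ne (key y hy).2] at h
    exact h2 x (key x hx).1 y (key y hy).1 h
  · rw [Function.update_of_ne (key x hx).2, Function.update_of_ne (key y hy).2]
    exact h3 x (key x hx).1 y (key y hy).1 e h
  · rw [Function.update_of_ne (key x hx).2, Function.update_of_ne (key y hy).2]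
    exact h4 x (key x hx).1 y (key y hy).1 e h
  · rw [Function.update_idem, Function.update_eq_self_iff]
    omega

/-- The branching rule: `d_μ` is the sum of the `d_ν` over the diagrams `ν` obtained from `μ` by
removing a corner. -/
theorem numSYT_eq_sum_corners {μ : YoungDiagram} (hμ : μ.card ≠ 0) :
    numSYT μ = ∑ c ∈ corners μ, numSYT (removeCell μ c) := by
  classical
  let F : (Σ c : corners μ, tableaux (removeCell μ c)) → tableaux μ := fun x =>
    ⟨Function.update x.2.1 x.1.1 (removeCell μ x.1).card, update_mem_tableaux x.1.2 x.2.2⟩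
  have hF : Function.Bijective F := by
    constructor
    · rintro ⟨⟨c, hc⟩, f, hf⟩ ⟨⟨c', hc'⟩, g, hg⟩ h
      have h := congrArg Subtype.val h
      simp only [F] at h
      have hcc : c = c' := by
        by_contra hne
        have h1 := congrFun h c
        rw [Function.update_self, Function.update_of_ne hne] at h1
        have h2 := hg.2.1 c ((mem_removeCell hc').2 ⟨(mem_corners.1 hc).1, hne⟩)
        have h3 := card_removeCell hc
        have h4 := card_removeCell hc'
        change (removeCell μ c).card = g c at h1
        change g c < (removeCell μ c').card at h2
        omega
      subst hcc
      have hfg : f = g := by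
        funext x
        by_cases hx : x = c
        · have hn : x ∉ removeCell μ c := fun hm => ((mem_removeCell hc).1 hm).2 hx
          rw [hf.1 x hn, hg.1 x hn]
        · have h1 := congrFun h x
          rwa [Function.update_of_ne hx, Function.update_of_ne hx] at h1
      subst hfg
      rfl
    · rintro ⟨f, hf⟩
      obtain ⟨c, hc, g, hg, rfl⟩ := exists_corner_of_mem_tableaux hμ hf
      exact ⟨⟨⟨c, hc⟩, g, hg⟩, rfl⟩
  rw [numSYT_eq_card_tableaux, ← Nat.card_congr (Equiv.ofBijective F hF), Nat.card_sigma,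
    ← Finset.sum_coe_sort (corners μ) fun c => numSYT (removeCell μ c)]
  exact Finset.sum_congr rfl fun c _ => (numSYT_eq_card_tableaux _).symm

theorem numSYT_of_card_eq_zero {μ : YoungDiagram} (hμ : μ.card = 0) : numSYT μ = 1 := by
  rw [numSYT_eq_card_tableaux, Nat.card_eq_one_iff_unique]
  have hn : ∀ c, c ∉ μ := fun c hc => by
    rw [Finset.card_eq_zero] at hμ
    rw [← YoungDiagram.mem_cells, hμ] at hc
    exact Finset.notMem_empty c hc
  exact ⟨⟨fun f g => Subtype.ext (funext fun c => (f.2.1 c (hn c)).trans (g.2.1 c (hn c)).symm)⟩,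
    ⟨fun _ => 0, fun _ _ => rfl, fun c hc => (hn c hc).elim, fun c hc => (hn c hc).elim,
      fun c hc => (hn c hc).elim, fun c hc => (hn c hc).elim⟩⟩

/-! ### A Vandermonde identity -/

/-- Rescaling the columns of a matrix by `c j`, one row at a time, sums up to multiplying the
determinant by `∑ j, c j`. -/
theorem sum_det_updateRow_mul {R n : Type*} [CommRing R] [Fintype n] [DecidableEq n]
    (M : Matrix n n R) (c : n → R) :
    ∑ i, (M.updateRow i fun j => c j * M i j).det = (∑ j, c j) * M.det := by
  simp only [Matrix.det_apply']
  rw [Finset.sum_comm, Finset.mul_sum]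
  refine Finset.sum_congr rfl fun σ _ => ?_
  rw [← Finset.mul_sum, ← Equiv.sum_comp σ]
  have h : ∀ k, ∏ j, (M.updateRow (σ k) fun j => c j * M (σ k) j) (σ j) j
      = c k * ∏ j, M (σ j) j := by
    intro k
    have h1 : ∀ j, (M.updateRow (σ k) fun j => c j * M (σ k) j) (σ j) j
        = (if k = j then c j else 1) * M (σ j) j := by
      intro j
      by_cases hj : k = j
      · subst hj
        simp
      · rw [Matrix.updateRow_ne fun h => hj (σ.injective h).symm, if_neg hj, one_mul]
    simp only [h1, Finset.prod_mul_distrib, Finset.prod_ite_eq, Finset.mem_univ, if_true]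
  simp only [h, ← Finset.sum_mul]
  ring

theorem sum_mul_det_vandermonde_update {N : ℕ} (v : Fin N → ℤ) :
    ∑ i, v i * (Matrix.vandermonde (Function.update v i (v i - 1))).det
      = (∑ i, v i - ∑ j : Fin N, (j : ℤ)) * (Matrix.vandermonde v).det := by
  have hV : ∀ w : Fin N → ℤ, (Matrix.vandermonde w).det
      = (Matrix.of fun i j : Fin N => (descPochhammer ℤ j).eval (w i)).det := fun w =>
    Matrix.det_eval_matrixOfPolynomials_eq_det_vandermonde w (fun j => descPochhammer ℤ j)
      (fun j => descPochhammer_natDegree ℤ j) (fun j => monic_descPochhammer ℤ j)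
  set M : Matrix (Fin N) (Fin N) ℤ := Matrix.of fun i j : Fin N => (descPochhammer ℤ j).eval (v i)
    with hM
  have hrow : ∀ i, v i * (Matrix.vandermonde (Function.update v i (v i - 1))).det
      = v i * M.det - (M.updateRow i fun j => (j : ℤ) * M i j).det := by
    intro i
    have h1 : (Matrix.of fun k j : Fin N =>
        (descPochhammer ℤ j).eval (Function.update v i (v i - 1) k))
        = M.updateRow i fun j => (descPochhammer ℤ j).eval (v i - 1) := by
      ext k j
      by_cases hk : k = i
      · subst hk
        simp
      · simp [hk, hM]
    -- The falling factorials satisfy `x * (x - 1)_j = (x)_{j + 1} = (x - j) * (x)_j`.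
    have h2 : ∀ j : Fin N, v i * (descPochhammer ℤ j).eval (v i - 1)
        = v i * M i j + -1 * ((j : ℤ) * M i j) := by
      intro j
      have e1 := congrArg (Polynomial.eval (v i)) (descPochhammer_succ_left ℤ (j : ℕ))
      rw [descPochhammer_succ_eval] at e1
      simp only [Polynomial.eval_mul, Polynomial.eval_X, Polynomial.eval_comp,
        Polynomial.eval_sub, Polynomial.eval_one] at e1
      rw [← e1, hM, Matrix.of_apply]
      ring
    rw [hV, h1, ← Matrix.det_updateRow_smul]
    have h3 : (v i • fun j : Fin N => (descPochhammer ℤ j).eval (v i - 1))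
        = (v i • M i) + (-1 : ℤ) • fun j : Fin N => (j : ℤ) * M i j := by
      funext j
      exact h2 j
    rw [h3, Matrix.det_updateRow_add, Matrix.det_updateRow_smul, Matrix.det_updateRow_smul,
      Matrix.updateRow_eq_self]
    ring
  rw [Finset.sum_congr rfl fun i _ => hrow i, Finset.sum_sub_distrib, sum_det_updateRow_mul,
    ← Finset.sum_mul, hV v]
  ring

/-- The product of the differences `x i - x j` over `i < j`. -/
def diffProd {N : ℕ} (x : Fin N → ℤ) : ℤ := ∏ i, ∏ j ∈ Finset.Ioi i, (x i - x j)

theorem diffProd_eq_det {N : ℕ} (x : Fin N → ℤ) :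
    diffProd x = (∏ i : Fin N, ∏ _j ∈ Finset.Ioi i, (-1 : ℤ)) * (Matrix.vandermonde x).det := by
  rw [Matrix.det_vandermonde, diffProd, ← Finset.prod_mul_distrib]
  refine Finset.prod_congr rfl fun i _ => ?_
  rw [← Finset.prod_mul_distrib]
  exact Finset.prod_congr rfl fun j _ => by ring

theorem sum_mul_diffProd_update {N : ℕ} (x : Fin N → ℤ) :
    ∑ i, x i * diffProd (Function.update x i (x i - 1))
      = (∑ i, x i - ∑ j : Fin N, (j : ℤ)) * diffProd x := by
  simp only [diffProd_eq_det, mul_left_comm _ (∏ i : Fin N, ∏ _j ∈ Finset.Ioi i, (-1 : ℤ)),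
    ← Finset.mul_sum, sum_mul_det_vandermonde_update]

theorem diffProd_pos {N : ℕ} {x : Fin N → ℤ} (hx : StrictAnti x) : 0 < diffProd x :=
  Finset.prod_pos fun _ _ => Finset.prod_pos fun _ hj => sub_pos.2 (hx (Finset.mem_Ioi.1 hj))

theorem diffProd_eq_zero {N : ℕ} {x : Fin N → ℤ} {i j : Fin N} (hij : i < j) (h : x i = x j) :
    diffProd x = 0 :=
  Finset.prod_eq_zero (Finset.mem_univ i)
    (Finset.prod_eq_zero (Finset.mem_Ioi.2 hij) (sub_eq_zero.2 h))

/-- The product of the factorials of the entries of a non-negative integer vector. -/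
def factProd {N : ℕ} (x : Fin N → ℤ) : ℕ := ∏ i, (x i).toNat !

theorem factProd_pos {N : ℕ} (x : Fin N → ℤ) : 0 < factProd x :=
  Finset.prod_pos fun _ _ => Nat.factorial_pos _

theorem factProd_eq_mul_update {N : ℕ} {x : Fin N → ℤ} {i : Fin N} (hi : 1 ≤ x i) :
    (factProd x : ℤ) = x i * factProd (Function.update x i (x i - 1)) := by
  have h : (x i).toNat ! = (x i).toNat * (x i - 1).toNat ! := by
    obtain ⟨m, hm⟩ := Int.eq_ofNat_of_zero_le (by omega : 0 ≤ x i - 1)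
    have hx : x i = ((m + 1 : ℕ) : ℤ) := by push_cast; omega
    rw [hm, hx, Int.toNat_natCast, Int.toNat_natCast, Nat.factorial_succ]
  have hcongr : ∏ k ∈ ({i}ᶜ : Finset (Fin N)), (Function.update x i (x i - 1) k).toNat !
      = ∏ k ∈ ({i}ᶜ : Finset (Fin N)), (x k).toNat ! := by
    refine Finset.prod_congr rfl fun k hk => ?_
    rw [Function.update_of_ne (by simpa using hk)]
  have hnat : factProd x = (x i).toNat * factProd (Function.update x i (x i - 1)) := by
    rw [factProd, factProd, Fintype.prod_eq_mul_prod_compl i, Fintype.prod_eq_mul_prod_compl i,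
      hcongr, Function.update_self, h, mul_assoc]
  rw [hnat, Nat.cast_mul, Int.toNat_of_nonneg (by omega)]

/-! ### Rows of a Young diagram and the Frobenius formula -/

theorem rowLen_eq_zero_of_le {μ : YoungDiagram} {N k : ℕ} (h : μ.rowLen N = 0) (hk : N ≤ k) :
    μ.rowLen k = 0 :=
  Nat.le_zero.1 (h ▸ μ.rowLen_anti N k hk)

theorem card_eq_sum_rowLen {μ : YoungDiagram} {N : ℕ} (h : μ.rowLen N = 0) :
    μ.card = ∑ i : Fin N, μ.rowLen i := by
  rw [Fin.sum_univ_eq_sum_range, YoungDiagram.card,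
    Finset.card_eq_sum_card_fiberwise (f := Prod.fst) (t := Finset.range N)]
  · exact Finset.sum_congr rfl fun i _ => (μ.rowLen_eq_card).symm
  · rintro ⟨i, j⟩ hc
    have hc := YoungDiagram.mem_iff_lt_rowLen.1 hc
    rw [Finset.mem_coe, Finset.mem_range]
    by_contra hN
    rw [rowLen_eq_zero_of_le h (not_lt.1 hN)] at hc
    omega

theorem ext_rowLen {μ ν : YoungDiagram} (h : ∀ i, μ.rowLen i = ν.rowLen i) : μ = ν := by
  ext ⟨i, j⟩
  rw [YoungDiagram.mem_cells, YoungDiagram.mem_cells, YoungDiagram.mem_iff_lt_rowLen,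
    YoungDiagram.mem_iff_lt_rowLen, h]

/-- The strictly decreasing vector `l_i = μ_i + (N - 1 - i)`, `0 ≤ i < N`, attached to a Young
diagram `μ` with at most `N` rows. -/
def shiftedRows (N : ℕ) (μ : YoungDiagram) (i : Fin N) : ℤ := μ.rowLen i + ((N : ℤ) - 1 - i)

theorem strictAnti_shiftedRows (N : ℕ) (μ : YoungDiagram) : StrictAnti (shiftedRows N μ) := by
  intro i j hij
  have h1 := μ.rowLen_anti i j hij.le
  have h2 : (i : ℕ) < j := hij
  simp only [shiftedRows]
  omega

theorem shiftedRows_nonneg (N : ℕ) (μ : YoungDiagram) (i : Fin N) : 0 ≤ shiftedRows N μ i := by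
  have := i.2
  simp only [shiftedRows]
  omega

theorem sum_shiftedRows {N : ℕ} {μ : YoungDiagram} (h : μ.rowLen N = 0) :
    ∑ i, shiftedRows N μ i - ∑ j : Fin N, (j : ℤ) = μ.card := by
  have hrev : ∑ i : Fin N, ((N : ℤ) - 1 - i) = ∑ j : Fin N, (j : ℤ) := by
    rw [← Equiv.sum_comp Fin.revPerm]
    refine Finset.sum_congr rfl fun i _ => ?_
    have := i.2
    simp only [Fin.revPerm_apply, Fin.val_rev]
    omega
  simp only [shiftedRows, Finset.sum_add_distrib, hrev, card_eq_sum_rowLen h]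
  push_cast
  ring

theorem rowLen_of_mem_corners {μ : YoungDiagram} {c : ℕ × ℕ} (hc : c ∈ corners μ) :
    μ.rowLen c.1 = c.2 + 1 := by
  obtain ⟨h1, _, h2⟩ := mem_corners.1 hc
  rw [YoungDiagram.mem_iff_lt_rowLen] at h1 h2
  omega

theorem rowLen_removeCell {μ : YoungDiagram} {c : ℕ × ℕ} (hc : c ∈ corners μ) (k : ℕ) :
    (removeCell μ c).rowLen k = if k = c.1 then c.2 else μ.rowLen k := by
  refine eq_of_forall_lt_iff fun j => ?_
  rw [← YoungDiagram.mem_iff_lt_rowLen, mem_removeCell hc, YoungDiagram.mem_iff_lt_rowLen]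
  have := rowLen_of_mem_corners hc
  split_ifs with hk
  · subst hk
    rw [Ne, Prod.ext_iff]
    simp only [true_and]
    omega
  · exact and_iff_left fun h => hk (congrArg Prod.fst h)

theorem shiftedRows_removeCell {N : ℕ} {μ : YoungDiagram} {c : ℕ × ℕ} (hc : c ∈ corners μ)
    {i : Fin N} (hi : (i : ℕ) = c.1) :
    shiftedRows N (removeCell μ c)
      = Function.update (shiftedRows N μ) i (shiftedRows N μ i - 1) := by
  have := rowLen_of_mem_corners hc
  funext k
  by_cases hk : k = i
  · subst hk
    rw [Function.update_self]
    simp only [shiftedRows, rowLen_removeCell hc, hi, if_true, this]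
    push_cast
    ring
  · have hk' : (k : ℕ) ≠ c.1 := fun h => hk (Fin.ext (h.trans hi.symm))
    rw [Function.update_of_ne hk]
    simp only [shiftedRows, rowLen_removeCell hc, if_neg hk']

/-- Only the removable rows contribute to the sum over rows in the Vandermonde identity: lowering
the coordinate of another row makes it equal to the next one, or that coordinate is `0`. -/
theorem sum_corners_diffProd {N : ℕ} {μ : YoungDiagram} (h : μ.rowLen N = 0)
    (e : corners μ → Fin N) (he : ∀ c, (e c : ℕ) = c.1.1) :
    ∑ c : corners μ, shiftedRows N μ (e c) * diffProd (shiftedRows N (removeCell μ c))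
      = μ.card * diffProd (shiftedRows N μ) := by
  rw [← sum_shiftedRows h, ← sum_mul_diffProd_update]
  refine Finset.sum_of_injOn e ?_ (fun _ _ => Finset.mem_coe.2 (Finset.mem_univ _)) ?_ ?_
  · intro c _ c' _ hcc
    have h1 : c.1.1 = c'.1.1 := by rw [← he, ← he, hcc]
    have h2 := rowLen_of_mem_corners c.2
    have h3 := rowLen_of_mem_corners c'.2
    rw [h1] at h2
    exact Subtype.ext (Prod.ext h1 (by omega))
  · intro i _ hi
    have hrow : μ.rowLen (i + 1) = μ.rowLen i := by
      by_contra hne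
      have hlt := lt_of_le_of_ne (μ.rowLen_anti i (i + 1) (Nat.le_succ _)) hne
      have hc : ((i : ℕ), μ.rowLen i - 1) ∈ corners μ := by
        simp only [mem_corners, YoungDiagram.mem_iff_lt_rowLen]
        omega
      exact hi ⟨⟨_, hc⟩, Finset.mem_coe.2 (Finset.mem_univ _), Fin.ext (he _)⟩
    by_cases hN : (i : ℕ) + 1 < N
    · have hlt : i < (⟨i + 1, hN⟩ : Fin N) := Nat.lt_succ_self _
      rw [diffProd_eq_zero hlt, mul_zero]
      rw [Function.update_self, Function.update_of_ne hlt.ne']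
      simp only [shiftedRows, hrow]
      push_cast
      ring
    · have hi' : (i : ℕ) + 1 = N := by have := i.2; omega
      have h0 : shiftedRows N μ i = 0 := by
        simp only [shiftedRows, ← hrow, hi', h]
        omega
      rw [h0, zero_mul]
  · intro c _
    rw [shiftedRows_removeCell c.2 (he c)]

/-- The Frobenius formula up to the value of the constant: for diagrams with at most `N` rows,
`d_μ / |μ|!` is proportional to `∏_{i < j} (l_i - l_j) / ∏ l_i!`. The constant is in fact `1`, but
only its positivity matters, so that the base case of the induction needs no computation. -/
theorem exists_frobenius_constant (N : ℕ) :
    ∃ C : ℝ, 0 < C ∧ ∀ μ : YoungDiagram, μ.rowLen N = 0 →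
      (numSYT μ : ℝ) * factProd (shiftedRows N μ)
        = C * μ.card ! * diffProd (shiftedRows N μ) := by
  have hbase : (0 : ℝ) < diffProd (shiftedRows N ⊥) := by
    exact_mod_cast diffProd_pos (strictAnti_shiftedRows N ⊥)
  have hfbase : (0 : ℝ) < factProd (shiftedRows N ⊥) := by
    exact_mod_cast factProd_pos (shiftedRows N ⊥)
  refine ⟨factProd (shiftedRows N ⊥) / diffProd (shiftedRows N ⊥), div_pos hfbase hbase, ?_⟩
  set C : ℝ := factProd (shiftedRows N ⊥) / diffProd (shiftedRows N ⊥) with hC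
  intro μ hμ
  induction hn : μ.card generalizing μ with
  | zero =>
    have hbot : μ = ⊥ := by
      rw [Finset.card_eq_zero] at hn
      exact YoungDiagram.ext hn
    rw [numSYT_of_card_eq_zero hn, hbot, hC]
    simp only [Nat.cast_one, one_mul, Nat.factorial_zero, mul_one]
    field_simp
  | succ n ih =>
    have hlt : ∀ c : corners μ, c.1.1 < N := by
      intro c
      by_contra hN
      have h1 := rowLen_of_mem_corners c.2
      rw [rowLen_eq_zero_of_le hμ (not_lt.1 hN)] at h1
      omega
    have hterm : ∀ c : corners μ, (numSYT (removeCell μ c) : ℝ) * factProd (shiftedRows N μ)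
        = C * n ! * ((shiftedRows N μ ⟨c.1.1, hlt c⟩ *
            diffProd (shiftedRows N (removeCell μ c)) : ℤ) : ℝ) := by
      intro c
      have hcard := card_removeCell c.2
      have hrow : (removeCell μ c).rowLen N = 0 := by
        rw [rowLen_removeCell c.2, if_neg (hlt c).ne', hμ]
      have hpos : 1 ≤ shiftedRows N μ ⟨c.1.1, hlt c⟩ := by
        have h1 := rowLen_of_mem_corners c.2
        have h2 := hlt c
        simp only [shiftedRows, h1]
        push_cast
        omega
      have hfact : (factProd (shiftedRows N μ) : ℝ) = shiftedRows N μ ⟨c.1.1, hlt c⟩ *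
          factProd (shiftedRows N (removeCell μ c)) := by
        rw [shiftedRows_removeCell (i := ⟨c.1.1, hlt c⟩) c.2 rfl]
        exact_mod_cast factProd_eq_mul_update hpos
      rw [hfact, mul_left_comm, ih _ hrow (by omega)]
      push_cast
      ring
    have hsum := sum_corners_diffProd hμ (fun c => ⟨c.1.1, hlt c⟩) fun _ => rfl
    rw [numSYT_eq_sum_corners (by omega), ← Finset.sum_coe_sort (corners μ) fun c =>
      numSYT (removeCell μ c), Nat.cast_sum, Finset.sum_mul,
      Finset.sum_congr rfl fun c _ => hterm c, ← Finset.mul_sum, ← Int.cast_sum, hsum, hn,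
      Nat.factorial_succ]
    push_cast
    ring

theorem rowLen_card (μ : YoungDiagram) : μ.rowLen μ.card = 0 := by
  by_contra h
  have hsub : (Finset.range (μ.card + 1)).image (fun i => (i, 0)) ⊆ μ.cells := by
    intro c hc
    obtain ⟨i, hi, rfl⟩ := Finset.mem_image.1 hc
    rw [YoungDiagram.mem_cells, YoungDiagram.mem_iff_lt_rowLen]
    have := μ.rowLen_anti i μ.card (Nat.lt_succ_iff.1 (Finset.mem_range.1 hi))
    omega
  have := Finset.card_le_card hsub
  rw [Finset.card_image_of_injective _ fun i j h => congrArg Prod.fst h, Finset.card_range] at this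
  exact (Nat.lt_succ_self _).not_ge this

theorem numSYT_pos (μ : YoungDiagram) : 0 < numSYT μ := by
  obtain ⟨C, hC, h⟩ := exists_frobenius_constant μ.card
  have h1 := h μ (rowLen_card μ)
  have h2 : (0 : ℝ) < diffProd (shiftedRows μ.card μ) := by
    exact_mod_cast diffProd_pos (strictAnti_shiftedRows _ μ)
  have h3 : (0 : ℝ) < C * μ.card ! * diffProd (shiftedRows μ.card μ) := by positivity
  rw [← h1] at h3
  exact_mod_cast pos_of_mul_pos_left h3 (Nat.cast_nonneg _)

/-! ### Log-concavity of the weights in shifted coordinates -/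

/-- The reciprocal `1 / t!` of the factorial, set to `0` at negative integers. -/
noncomputable def invFact (t : ℤ) : ℝ := if 0 ≤ t then ((t.toNat ! : ℕ) : ℝ)⁻¹ else 0

theorem invFact_nonneg (t : ℤ) : 0 ≤ invFact t := by
  unfold invFact
  split_ifs <;> positivity

theorem invFact_succ {t : ℤ} (ht : 0 ≤ t) : invFact t = (t + 1) * invFact (t + 1) := by
  obtain ⟨m, rfl⟩ := Int.eq_ofNat_of_zero_le ht
  have h1 : ((m : ℤ) + 1).toNat = m + 1 := by omega
  rw [invFact, invFact, if_pos ht, if_pos (by omega), Int.toNat_natCast, h1, Nat.factorial_succ]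
  push_cast
  field_simp

/-- This is log-concavity of `t ↦ 1 / t!`. -/
theorem invFact_mul_le (u v : ℤ) :
    invFact u * invFact (v - 1) ≤ invFact (min u v) * invFact (max u v - 1) := by
  rcases le_or_gt u v with h | h
  · rw [min_eq_left h, max_eq_right h]
  rw [min_eq_right h.le, max_eq_left h.le]
  rcases lt_or_ge (v - 1) 0 with hv | hv
  · rw [invFact, invFact, if_neg (not_le.2 hv), mul_zero]
    exact mul_nonneg (invFact_nonneg _) (invFact_nonneg _)
  have e1 := invFact_succ hv
  have e2 := invFact_succ (t := u - 1) (by omega)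
  rw [sub_add_cancel] at e1 e2
  rw [e1, e2]
  have h0 := mul_nonneg (invFact_nonneg u) (invFact_nonneg v)
  have huv : (v : ℝ) ≤ u := by exact_mod_cast h.le
  push_cast
  nlinarith

/-- Supermodularity of `log (u₁ - u₂)`, which comes from concavity of the logarithm. -/
theorem max_sub_mul_le (u₁ u₂ v₁ v₂ : ℤ) :
    max 0 (u₁ - u₂) * max 0 (v₁ - v₂)
      ≤ max 0 (min u₁ v₁ - min u₂ v₂) * max 0 (max u₁ v₁ - max u₂ v₂) := by
  have hR := mul_nonneg (le_max_left 0 (min u₁ v₁ - min u₂ v₂))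
    (le_max_left 0 (max u₁ v₁ - max u₂ v₂))
  rcases le_or_gt (u₁ - u₂) 0 with h | hu
  · rwa [max_eq_left h, zero_mul]
  rcases le_or_gt (v₁ - v₂) 0 with h | hv
  · rwa [max_eq_left h, mul_zero]
  rcases le_total u₁ v₁ with h1 | h1 <;> rcases le_total u₂ v₂ with h2 | h2
  · simp only [min_eq_left h1, min_eq_left h2, max_eq_right h1, max_eq_right h2, le_refl]
  · simp only [min_eq_left h1, min_eq_right h2, max_eq_right h1, max_eq_left h2]
    rw [max_eq_right hu.le, max_eq_right hv.le, max_eq_right (by omega), max_eq_right (by omega)]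
    nlinarith [mul_nonneg (sub_nonneg.2 h1) (sub_nonneg.2 h2)]
  · simp only [min_eq_right h1, min_eq_left h2, max_eq_left h1, max_eq_right h2]
    rw [max_eq_right hu.le, max_eq_right hv.le, max_eq_right (by omega), max_eq_right (by omega)]
    nlinarith [mul_nonneg (sub_nonneg.2 h1) (sub_nonneg.2 h2)]
  · simp only [min_eq_right h1, min_eq_right h2, max_eq_left h1, max_eq_left h2]
    rw [mul_comm]

/-- The product `∏_{i < j} (x_i - x_j) / ∏ x_i!`, set to `0` unless `x` is strictly decreasing and
non-negative. -/
noncomputable def frob {N : ℕ} (x : Fin N → ℤ) : ℝ :=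
  (∏ i, ∏ j ∈ Finset.Ioi i, ((max 0 (x i - x j) : ℤ) : ℝ)) * ∏ i, invFact (x i)

theorem frob_nonneg {N : ℕ} (x : Fin N → ℤ) : 0 ≤ frob x :=
  mul_nonneg
    (Finset.prod_nonneg fun _ _ => Finset.prod_nonneg fun _ _ =>
      Int.cast_nonneg (le_max_left _ _))
    (Finset.prod_nonneg fun _ _ => invFact_nonneg _)

theorem frob_mul_frob_le {N : ℕ} (u v : Fin N → ℤ) :
    frob u * frob (v - 1) ≤ frob (u ⊓ v) * frob (u ⊔ v - 1) := by
  unfold frob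
  rw [mul_mul_mul_comm, mul_mul_mul_comm (∏ i, ∏ j ∈ Finset.Ioi i,
    ((max 0 ((u ⊓ v) i - (u ⊓ v) j) : ℤ) : ℝ))]
  have h0 : ∀ a b : ℤ, (0 : ℝ) ≤ ((max 0 a : ℤ) : ℝ) * ((max 0 b : ℤ) : ℝ) := fun a b =>
    mul_nonneg (Int.cast_nonneg (le_max_left _ _)) (Int.cast_nonneg (le_max_left _ _))
  simp only [← Finset.prod_mul_distrib]
  have h1 : ∀ a b : ℤ, 0 ≤ invFact a * invFact b := fun a b =>
    mul_nonneg (invFact_nonneg _) (invFact_nonneg _)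
  refine Finset.prod_le_prod
    (fun i _ => mul_nonneg (Finset.prod_nonneg fun j _ => h0 _ _) (h1 _ _)) fun i _ =>
    mul_le_mul (Finset.prod_le_prod (fun j _ => h0 _ _) fun j _ => ?_)
      (invFact_mul_le (u i) (v i)) (h1 _ _) (Finset.prod_nonneg fun j _ => h0 _ _)
  have h := max_sub_mul_le (u i) (u j) (v i) (v j)
  simp only [Pi.sub_apply, Pi.one_apply, sub_sub_sub_cancel_right, Pi.inf_apply, Pi.sup_apply]
  exact_mod_cast h

/-- The weight of a partition in shifted coordinates, up to a constant. -/
noncomputable def shiftedWeight (α β : ℝ) {N : ℕ} (x : Fin N → ℤ) : ℝ :=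
  α ^ (∑ i, x i) * frob x ^ β

theorem shiftedWeight_nonneg {α : ℝ} (hα : 0 < α) (β : ℝ) {N : ℕ} (x : Fin N → ℤ) :
    0 ≤ shiftedWeight α β x :=
  mul_nonneg (zpow_pos hα _).le (Real.rpow_nonneg (frob_nonneg x) _)

/-- Translation-supermodularity of the logarithm of the weight. It is a discrete form of concavity,
stated as the hypothesis of the four functions theorem. -/
theorem shiftedWeight_mul_le {α β : ℝ} (hα : 0 < α) (hβ : 0 < β) {N : ℕ} (u v : Fin N → ℤ) :
    shiftedWeight α β u * shiftedWeight α β (v - 1)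
      ≤ shiftedWeight α β (u ⊓ v) * shiftedWeight α β (u ⊔ v - 1) := by
  have hsum : ∑ i, (u ⊓ v) i + ∑ i, (u ⊔ v - 1) i = ∑ i, u i + ∑ i, (v - 1) i := by
    rw [← Finset.sum_add_distrib, ← Finset.sum_add_distrib]
    refine Finset.sum_congr rfl fun i _ => ?_
    have := min_add_max (u i) (v i)
    simp only [Pi.sub_apply, Pi.one_apply, Pi.inf_apply, Pi.sup_apply]
    omega
  unfold shiftedWeight
  rw [mul_mul_mul_comm, mul_mul_mul_comm (α ^ (∑ i, (u ⊓ v) i)), ← zpow_add₀ hα.ne',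
    ← zpow_add₀ hα.ne', hsum, ← Real.mul_rpow (frob_nonneg _) (frob_nonneg _),
    ← Real.mul_rpow (frob_nonneg _) (frob_nonneg _)]
  refine mul_le_mul_of_nonneg_left ?_ (zpow_pos hα _).le
  exact Real.rpow_le_rpow (mul_nonneg (frob_nonneg _) (frob_nonneg _)) (frob_mul_frob_le u v) hβ.le

/-! ### Partitions in shifted coordinates -/

theorem exists_rowLen_eq {f : ℕ → ℕ} (hf : Antitone f) {N : ℕ} (hN : f N = 0) :
    ∃ μ : YoungDiagram, ∀ i, μ.rowLen i = f i := by
  let μ : YoungDiagram :=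
    { cells := (Finset.range N ×ˢ Finset.range (f 0)).filter fun c => c.2 < f c.1
      isLowerSet := by
        rintro ⟨i, j⟩ ⟨i', j'⟩ ⟨hi, hj⟩ hc
        simp only [Finset.coe_filter, Finset.mem_product, Finset.mem_range,
          Set.mem_ofPred_eq] at hc hi hj ⊢
        have := hf hi
        omega }
  refine ⟨μ, fun i => eq_of_forall_lt_iff fun j => ?_⟩
  rw [← YoungDiagram.mem_iff_lt_rowLen]
  change (i, j) ∈ (Finset.range N ×ˢ Finset.range (f 0)).filter _ ↔ _
  simp only [Finset.mem_filter, Finset.mem_product, Finset.mem_range]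
  refine ⟨fun h => h.2, fun h => ⟨⟨?_, h.trans_le (hf (Nat.zero_le i))⟩, h⟩⟩
  by_contra hi
  have := hf (not_lt.1 hi)
  omega

theorem add_le_of_strictAnti {N : ℕ} {x : Fin N → ℤ} (hx : StrictAnti x) (d : ℕ) (i j : Fin N)
    (h : (j : ℕ) = i + d) : x j + d ≤ x i := by
  induction d generalizing j with
  | zero =>
    have : j = i := Fin.ext h
    simp [this]
  | succ d ih =>
    have hj := j.2
    have h1 := ih ⟨i + d, by omega⟩ rfl
    have h2 : x j < x ⟨i + d, by omega⟩ := hx (Fin.lt_def.2 (by simp only [h]; omega))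
    push_cast
    omega

theorem exists_shiftedRows_eq {N : ℕ} {x : Fin N → ℤ} (hx : StrictAnti x) (h0 : ∀ i, 0 ≤ x i) :
    ∃ μ : YoungDiagram, μ.rowLen N = 0 ∧ shiftedRows N μ = x := by
  have hge : ∀ i : Fin N, (N : ℤ) - 1 - i ≤ x i := by
    intro i
    have hi := i.2
    have h1 := add_le_of_strictAnti hx (N - 1 - i) i ⟨N - 1, by omega⟩ (by simp only; omega)
    have h2 := h0 ⟨N - 1, by omega⟩
    omega
  let f : ℕ → ℕ := fun k => if h : k < N then (x ⟨k, h⟩ - ((N : ℤ) - 1 - k)).toNat else 0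
  have hf : Antitone f := by
    intro k l hkl
    by_cases hl : l < N
    · have hk := hkl.trans_lt hl
      have h1 := add_le_of_strictAnti hx (l - k) ⟨k, hk⟩ ⟨l, hl⟩ (by simp only; omega)
      simp only [f, dif_pos hl, dif_pos hk]
      omega
    · simp only [f, dif_neg hl, Nat.zero_le]
  have hfN : f N = 0 := dif_neg (lt_irrefl N)
  obtain ⟨μ, hμ⟩ := exists_rowLen_eq hf hfN
  refine ⟨μ, (hμ N).trans hfN, funext fun i => ?_⟩
  have h1 := hge i
  simp only [shiftedRows, hμ, f, dif_pos i.2, Fin.eta]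
  omega

theorem strictAnti_and_nonneg_of_frob_ne_zero {N : ℕ} {x : Fin N → ℤ} (h : frob x ≠ 0) :
    StrictAnti x ∧ ∀ i, 0 ≤ x i := by
  obtain ⟨h1, h2⟩ := mul_ne_zero_iff.1 h
  refine ⟨fun i j hij => ?_, fun i => ?_⟩
  · by_contra hle
    refine Finset.prod_ne_zero_iff.1 (Finset.prod_ne_zero_iff.1 h1 i (Finset.mem_univ i)) j
      (Finset.mem_Ioi.2 hij) ?_
    rw [max_eq_left (by omega), Int.cast_zero]
  · by_contra hlt
    exact Finset.prod_ne_zero_iff.1 h2 i (Finset.mem_univ i) (if_neg hlt)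

theorem frob_eq_of_strictAnti {N : ℕ} {x : Fin N → ℤ} (hx : StrictAnti x) (h0 : ∀ i, 0 ≤ x i) :
    frob x = diffProd x / factProd x := by
  rw [frob, diffProd, factProd, div_eq_mul_inv]
  push_cast
  rw [← Finset.prod_inv_distrib]
  congr 1
  · refine Finset.prod_congr rfl fun i _ => Finset.prod_congr rfl fun j hj => ?_
    rw [max_eq_right]
    exact_mod_cast (sub_pos.2 (hx (Finset.mem_Ioi.1 hj))).le
  · exact Finset.prod_congr rfl fun i _ => if_pos (h0 i)

/-- The unnormalized mass `α ^ |μ| * (d_μ / |μ|!) ^ β` of a partition `μ`. -/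
noncomputable def weight (α β : ℝ) (μ : YoungDiagram) : ℝ :=
  α ^ μ.card * ((numSYT μ : ℝ) / μ.card !) ^ β

theorem weight_pos {α : ℝ} (hα : 0 < α) (β : ℝ) (μ : YoungDiagram) : 0 < weight α β μ := by
  have : (0 : ℝ) < numSYT μ := by exact_mod_cast numSYT_pos μ
  unfold weight
  positivity

theorem exists_weight_constant {α : ℝ} (hα : 0 < α) (β : ℝ) (N : ℕ) :
    ∃ C : ℝ, 0 < C ∧ ∀ μ : YoungDiagram, μ.rowLen N = 0 →
      weight α β μ = C * shiftedWeight α β (shiftedRows N μ) := by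
  obtain ⟨C, hC, h⟩ := exists_frobenius_constant N
  refine ⟨C ^ β * α ^ (-∑ j : Fin N, (j : ℤ)), by positivity, fun μ hμ => ?_⟩
  have hf : (factProd (shiftedRows N μ) : ℝ) ≠ 0 := by
    exact_mod_cast (factProd_pos (shiftedRows N μ)).ne'
  have h1 : (numSYT μ : ℝ) / μ.card ! = C * frob (shiftedRows N μ) := by
    rw [frob_eq_of_strictAnti (strictAnti_shiftedRows N μ) (shiftedRows_nonneg N μ)]
    have := h μ hμ
    field_simp
    linarith
  have h2 : α ^ μ.card = α ^ (-∑ j : Fin N, (j : ℤ)) * α ^ (∑ i, shiftedRows N μ i) := by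
    rw [← zpow_add₀ hα.ne', neg_add_eq_sub, sum_shiftedRows hμ, zpow_natCast]
  rw [weight, shiftedWeight, h1, h2, Real.mul_rpow hC.le (frob_nonneg _)]
  ring

theorem shiftedRows_injOn (N : ℕ) :
    Set.InjOn (shiftedRows N) {μ : YoungDiagram | μ.rowLen N = 0} := by
  intro μ hμ ν hν h
  refine ext_rowLen fun i => ?_
  by_cases hi : i < N
  · have := congrFun h ⟨i, hi⟩
    simpa [shiftedRows] using this
  · rw [rowLen_eq_zero_of_le hμ (not_lt.1 hi), rowLen_eq_zero_of_le hν (not_lt.1 hi)]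

/-- A finite sum of shifted weights over vectors with a prescribed coordinate is a finite sum of
weights over partitions with a prescribed row length. -/
theorem exists_sum_weight_eq {α β : ℝ} (hβ : 0 < β) {N : ℕ} {C : ℝ}
    (hC : ∀ μ : YoungDiagram, μ.rowLen N = 0 →
      weight α β μ = C * shiftedWeight α β (shiftedRows N μ))
    (r : Fin N) (k : ℤ) (X : Finset (Fin N → ℤ)) :
    ∃ D : Finset YoungDiagram, (∀ μ ∈ D, (μ.rowLen r : ℤ) = k) ∧
      ∑ μ ∈ D, weight α β μ = C * ∑ x ∈ X, if x r = k + ((N : ℤ) - 1 - r) then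
        shiftedWeight α β x else 0 := by
  classical
  set Y := X.filter fun x => x r = k + ((N : ℤ) - 1 - r) ∧ frob x ≠ 0 with hY
  have hex : ∀ x : Fin N → ℤ, ∃ μ : YoungDiagram,
      frob x ≠ 0 → μ.rowLen N = 0 ∧ shiftedRows N μ = x := by
    intro x
    by_cases hx : frob x = 0
    · exact ⟨⊥, fun h => (h hx).elim⟩
    · obtain ⟨h1, h2⟩ := strictAnti_and_nonneg_of_frob_ne_zero hx
      obtain ⟨μ, hμ⟩ := exists_shiftedRows_eq h1 h2
      exact ⟨μ, fun _ => hμ⟩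
  choose g hg using hex
  refine ⟨Y.image g, fun μ hμ => ?_, ?_⟩
  · obtain ⟨x, hx, rfl⟩ := Finset.mem_image.1 hμ
    obtain ⟨_, h1, h2⟩ := Finset.mem_filter.1 hx
    have h3 := congrFun (hg x h2).2 r
    rw [h1] at h3
    simpa [shiftedRows] using h3
  · rw [Finset.sum_image, Finset.mul_sum]
    · rw [hY, Finset.sum_filter]
      refine Finset.sum_congr rfl fun x _ => ?_
      by_cases h1 : x r = k + ((N : ℤ) - 1 - r)
      · by_cases h2 : frob x = 0
        · rw [if_neg fun h => h.2 h2, if_pos h1, shiftedWeight, h2, Real.zero_rpow hβ.ne',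
            mul_zero, mul_zero]
        · rw [if_pos ⟨h1, h2⟩, if_pos h1, hC _ (hg x h2).1, (hg x h2).2]
      · rw [if_neg fun h => h1 h.1, if_neg h1, mul_zero]
    · intro x hx y hy h
      rw [← (hg x (Finset.mem_filter.1 hx).2.2).2, ← (hg y (Finset.mem_filter.1 hy).2.2).2, h]

open scoped FinsetFamily in
/-- The four functions theorem applied to vectors with coordinate `r` equal to `k + 1`, to `k - 1`
and (on the right-hand side) to `k`. -/
theorem sum_shiftedWeight_mul_sum_le {α β : ℝ} (hα : 0 < α) (hβ : 0 < β) {N : ℕ} (r : Fin N)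
    (k : ℤ) (S T : Finset (Fin N → ℤ)) (hS : ∀ x ∈ S, x r = k + 1) (hT : ∀ x ∈ T, x r = k - 1) :
    ∃ X Y : Finset (Fin N → ℤ),
      (∑ x ∈ S, shiftedWeight α β x) * ∑ x ∈ T, shiftedWeight α β x
        ≤ (∑ x ∈ X, if x r = k then shiftedWeight α β x else 0) *
          ∑ x ∈ Y, if x r = k then shiftedWeight α β x else 0 := by
  classical
  have hinj : Function.Injective fun x : Fin N → ℤ => x - 1 := sub_left_injective
  have hinj' : Function.Injective fun x : Fin N → ℤ => x + 1 := add_left_injective 1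
  have hnn : ∀ x : Fin N → ℤ, 0 ≤ shiftedWeight α β x := shiftedWeight_nonneg hα β
  have h4 := four_functions_theorem
    (f₁ := fun x : Fin N → ℤ => if x r = k + 1 then shiftedWeight α β x else 0)
    (f₂ := fun x => if x r = k then shiftedWeight α β (x - 1) else 0)
    (f₃ := fun x => if x r = k then shiftedWeight α β x else 0)
    (f₄ := fun x => if x r = k + 1 then shiftedWeight α β (x - 1) else 0)
    (fun x => by dsimp only; split_ifs <;> simp [hnn])
    (fun x => by dsimp only; split_ifs <;> simp [hnn])
    (fun x => by dsimp only; split_ifs <;> simp [hnn])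
    (fun x => by dsimp only; split_ifs <;> simp [hnn])
    (fun u v => by
      by_cases hu : u r = k + 1
      · by_cases hv : v r = k
        · have h1 : (u ⊓ v) r = k := by rw [Pi.inf_apply, hu, hv]; exact min_eq_right (by omega)
          have h2 : (u ⊔ v) r = k + 1 := by
            rw [Pi.sup_apply, hu, hv]; exact max_eq_left (by omega)
          simp only [hu, hv, h1, h2, if_true]
          exact shiftedWeight_mul_le hα hβ u v
        · simp only [hv, if_false, mul_zero]
          exact mul_nonneg (by split_ifs <;> simp [hnn]) (by split_ifs <;> simp [hnn])
      · simp only [hu, if_false, zero_mul]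
        exact mul_nonneg (by split_ifs <;> simp [hnn]) (by split_ifs <;> simp [hnn]))
    S (T.image fun x => x + 1)
  refine ⟨S ⊼ T.image fun x => x + 1, (S ⊻ T.image fun x => x + 1).image fun x => x - 1, ?_⟩
  rw [Finset.sum_image hinj.injOn]
  rw [Finset.sum_image hinj'.injOn] at h4
  refine le_trans (le_of_eq ?_) (h4.trans (le_of_eq ?_))
  · congr 1
    · exact Finset.sum_congr rfl fun x hx => (if_pos (hS x hx)).symm
    · refine Finset.sum_congr rfl fun x hx => ?_
      rw [if_pos (by simp [hT x hx]), add_sub_cancel_right]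
  · congr 1
    refine Finset.sum_congr rfl fun x _ => ?_
    simp only [Pi.sub_apply, Pi.one_apply, sub_eq_iff_eq_add]

theorem sum_weight_mul_sum_le {α β : ℝ} (hα : 0 < α) (hβ : 0 < β) (r : ℕ) (k : ℤ)
    (A B : Finset YoungDiagram) (hA : ∀ μ ∈ A, (μ.rowLen r : ℤ) = k + 1)
    (hB : ∀ μ ∈ B, (μ.rowLen r : ℤ) = k - 1) :
    ∃ D E : Finset YoungDiagram, (∀ μ ∈ D, (μ.rowLen r : ℤ) = k) ∧
      (∀ μ ∈ E, (μ.rowLen r : ℤ) = k) ∧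
      (∑ μ ∈ A, weight α β μ) * ∑ μ ∈ B, weight α β μ
        ≤ (∑ μ ∈ D, weight α β μ) * ∑ μ ∈ E, weight α β μ := by
  classical
  -- All diagrams in play have fewer than `N` rows, and the row `r` is among the first `N`.
  set N := r + 1 + ∑ μ ∈ A ∪ B, μ.card with hN
  have hrow : ∀ μ ∈ A ∪ B, μ.rowLen N = 0 := fun μ hμ => by
    have : μ.card ≤ ∑ μ ∈ A ∪ B, μ.card :=
      Finset.single_le_sum (f := fun μ : YoungDiagram => μ.card) (fun _ _ => Nat.zero_le _) hμ
    exact rowLen_eq_zero_of_le (rowLen_card μ) (by omega)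
  obtain ⟨C, hC0, hC⟩ := exists_weight_constant hα β N
  have hsum : ∀ F : Finset YoungDiagram, F ⊆ A ∪ B → ∑ μ ∈ F, weight α β μ
      = C * ∑ x ∈ F.image (shiftedRows N), shiftedWeight α β x := by
    intro F hF
    rw [Finset.sum_image fun μ hμ ν hν h =>
      shiftedRows_injOn N (hrow μ (hF hμ)) (hrow ν (hF hν)) h, Finset.mul_sum]
    exact Finset.sum_congr rfl fun μ hμ => hC μ (hrow μ (hF hμ))
  let s : Fin N := ⟨r, by omega⟩
  obtain ⟨X, Y, hXY⟩ := sum_shiftedWeight_mul_sum_le hα hβ s (k + ((N : ℤ) - 1 - r))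
    (A.image (shiftedRows N)) (B.image (shiftedRows N))
    (fun x hx => by
      obtain ⟨μ, hμ, rfl⟩ := Finset.mem_image.1 hx
      simp only [shiftedRows, s, hA μ hμ]
      ring)
    (fun x hx => by
      obtain ⟨μ, hμ, rfl⟩ := Finset.mem_image.1 hx
      simp only [shiftedRows, s, hB μ hμ]
      ring)
  obtain ⟨D, hD, hDX⟩ := exists_sum_weight_eq hβ hC s k X
  obtain ⟨E, hE, hEY⟩ := exists_sum_weight_eq hβ hC s k Y
  refine ⟨D, E, hD, hE, ?_⟩
  rw [hDX, hEY, hsum A Finset.subset_union_left, hsum B Finset.subset_union_right,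
    mul_mul_mul_comm C _ C, mul_mul_mul_comm C _ C]
  exact mul_le_mul_of_nonneg_left hXY (by positivity)

/-! ### Finiteness of the normalizing constant -/

theorem eq_of_mem_corners_of_fst_eq {μ : YoungDiagram} {c c' : ℕ × ℕ} (hc : c ∈ corners μ)
    (hc' : c' ∈ corners μ) (h : c.1 = c'.1) : c = c' := by
  rcases le_total c.2 c'.2 with h2 | h2
  · exact (eq_of_mem_corners_of_le hc (mem_corners.1 hc').1 ⟨h.le, h2⟩).symm
  · exact eq_of_mem_corners_of_le hc' (mem_corners.1 hc).1 ⟨h.ge, h2⟩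

theorem eq_of_mem_corners_of_snd_eq {μ : YoungDiagram} {c c' : ℕ × ℕ} (hc : c ∈ corners μ)
    (hc' : c' ∈ corners μ) (h : c.2 = c'.2) : c = c' := by
  rcases le_total c.1 c'.1 with h2 | h2
  · exact (eq_of_mem_corners_of_le hc (mem_corners.1 hc').1 ⟨h2, h.le⟩).symm
  · exact eq_of_mem_corners_of_le hc' (mem_corners.1 hc).1 ⟨h2, h.ge⟩

/-- Two corners span a cell of the diagram, in the row of the upper one and the column of the lower
one, and this cell determines both corners. -/
theorem card_corners_sq_le (μ : YoungDiagram) : (corners μ).card ^ 2 ≤ 2 * μ.card := by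
  have h1 : (((corners μ) ×ˢ (corners μ)).filter fun p => p.1.1 ≤ p.2.1).card ≤ μ.card := by
    refine Finset.card_le_card_of_injOn (fun p => (p.1.1, p.2.2)) ?_ ?_
    · rintro ⟨c, c'⟩ hp
      obtain ⟨hp, hle⟩ := Finset.mem_filter.1 hp
      exact μ.up_left_mem hle le_rfl (mem_corners.1 (Finset.mem_product.1 hp).2).1
    · rintro ⟨c, c'⟩ hp ⟨e, e'⟩ hq h
      have hp := Finset.mem_product.1 (Finset.mem_filter.1 hp).1
      have hq := Finset.mem_product.1 (Finset.mem_filter.1 hq).1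
      obtain ⟨h1, h2⟩ := Prod.ext_iff.1 h
      exact Prod.ext (eq_of_mem_corners_of_fst_eq hp.1 hq.1 h1)
        (eq_of_mem_corners_of_snd_eq hp.2 hq.2 h2)
  have h2 : (((corners μ) ×ˢ (corners μ)).filter fun p => ¬ p.1.1 ≤ p.2.1).card ≤ μ.card := by
    refine Finset.card_le_card_of_injOn (fun p => (p.2.1, p.1.2)) ?_ ?_
    · rintro ⟨c, c'⟩ hp
      obtain ⟨hp, hle⟩ := Finset.mem_filter.1 hp
      exact μ.up_left_mem (not_le.1 hle).le le_rfl (mem_corners.1 (Finset.mem_product.1 hp).1).1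
    · rintro ⟨c, c'⟩ hp ⟨e, e'⟩ hq h
      have hp := Finset.mem_product.1 (Finset.mem_filter.1 hp).1
      have hq := Finset.mem_product.1 (Finset.mem_filter.1 hq).1
      obtain ⟨h1, h2⟩ := Prod.ext_iff.1 h
      exact Prod.ext (eq_of_mem_corners_of_snd_eq hp.1 hq.1 h2)
        (eq_of_mem_corners_of_fst_eq hp.2 hq.2 h1)
  have h3 := Finset.card_filter_add_card_filter_not (s := (corners μ) ×ˢ (corners μ))
    (fun p => p.1.1 ≤ p.2.1)
  rw [Finset.card_product] at h3
  rw [sq]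
  omega

/-- A diagram with `n` cells has at most `√(2n)` corners, so by the branching rule
`d_μ ≤ √(2 ^ n * n!)`. -/
theorem numSYT_sq_le (μ : YoungDiagram) : numSYT μ ^ 2 ≤ 2 ^ μ.card * μ.card ! := by
  induction hn : μ.card generalizing μ with
  | zero => simp [numSYT_of_card_eq_zero hn]
  | succ n ih =>
    rw [numSYT_eq_sum_corners (by omega)]
    calc (∑ c ∈ corners μ, numSYT (removeCell μ c)) ^ 2
        ≤ (corners μ).card * ∑ c ∈ corners μ, numSYT (removeCell μ c) ^ 2 :=
          sq_sum_le_card_mul_sum_sq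
      _ ≤ (corners μ).card * ∑ c ∈ corners μ, 2 ^ n * n ! := by
          gcongr with c hc
          exact ih _ (by have := card_removeCell hc; omega)
      _ = (corners μ).card ^ 2 * (2 ^ n * n !) := by
          rw [Finset.sum_const, smul_eq_mul]
          ring
      _ ≤ (2 * (n + 1)) * (2 ^ n * n !) := by
          gcongr
          exact hn ▸ card_corners_sq_le μ
      _ = 2 ^ (n + 1) * (n + 1)! := by
          rw [Nat.factorial_succ]
          ring

theorem sum_rowLens (μ : YoungDiagram) : μ.rowLens.sum = μ.card := by
  have h : μ.rowLen (μ.colLen 0) = 0 := by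
    by_contra h
    exact lt_irrefl _ (YoungDiagram.mem_iff_lt_colLen.1
      (YoungDiagram.mem_iff_lt_rowLen.2 (Nat.pos_of_ne_zero h)))
  rw [card_eq_sum_rowLen h, Fin.sum_univ_eq_sum_range, YoungDiagram.rowLens,
    Finset.sum_range, Fin.sum_univ_def, ← List.map_coe_finRange_eq_range, List.map_map]
  rfl

/-- A partition of `n`, read as a composition of `n` by listing its row lengths. -/
def toComposition {n : ℕ} (p : Partitions n) : Composition n where
  blocks := p.1.rowLens
  blocks_pos := fun {i} hi => p.1.pos_of_mem_rowLens i hi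
  blocks_sum := (sum_rowLens p.1).trans p.2

theorem toComposition_injective (n : ℕ) :
    Function.Injective (toComposition : Partitions n → Composition n) := by
  intro p q h
  refine Subtype.ext (YoungDiagram.equivListRowLens.injective (Subtype.ext ?_))
  exact congrArg Composition.blocks h

instance finite_partitions (n : ℕ) : Finite (Partitions n) :=
  Finite.of_injective _ (toComposition_injective n)

theorem card_partitions_le (n : ℕ) : Nat.card (Partitions n) ≤ 2 ^ n := by
  refine (Nat.card_le_card_of_injective _ (toComposition_injective n)).trans ?_
  rw [Nat.card_eq_fintype_card, composition_card]
  exact Nat.pow_le_pow_right two_pos (Nat.sub_le n 1)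

theorem weight_le {α β : ℝ} (hα : 0 < α) (hβ : 0 < β) (μ : YoungDiagram) :
    weight α β μ ≤ α ^ μ.card * ((2 : ℝ) ^ μ.card / μ.card !) ^ (β / 2) := by
  have h0 : (0 : ℝ) ≤ (numSYT μ : ℝ) / μ.card ! := by positivity
  have h1 : ((numSYT μ : ℝ) / μ.card !) ^ 2 ≤ (2 : ℝ) ^ μ.card / μ.card ! := by
    have h : ((numSYT μ : ℝ)) ^ 2 ≤ 2 ^ μ.card * μ.card ! := by exact_mod_cast numSYT_sq_le μ
    have hf : (0 : ℝ) < μ.card ! := by positivity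
    rw [div_pow, div_le_div_iff₀ (by positivity) hf]
    nlinarith
  have h2 : ((numSYT μ : ℝ) / μ.card !) ^ β = (((numSYT μ : ℝ) / μ.card !) ^ 2) ^ (β / 2) := by
    rw [← Real.rpow_natCast, ← Real.rpow_mul h0]
    congr 1
    push_cast
    ring
  rw [weight, h2]
  gcongr

/-- The factor `2 ^ n` bounds the number of partitions of `n`. -/
theorem summable_weight_bound {α β : ℝ} (hα : 0 < α) (hβ : 0 < β) :
    Summable fun n : ℕ => (2 : ℝ) ^ n * (α ^ n * ((2 : ℝ) ^ n / n !) ^ (β / 2)) := by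
  refine summable_of_ratio_test_tendsto_lt_one (l := 0) zero_lt_one
    (Filter.Eventually.of_forall fun n => by positivity) ?_
  have hratio : ∀ n : ℕ,
      ‖(2 : ℝ) ^ (n + 1) * (α ^ (n + 1) * ((2 : ℝ) ^ (n + 1) / (n + 1)!) ^ (β / 2))‖ /
        ‖(2 : ℝ) ^ n * (α ^ n * ((2 : ℝ) ^ n / n !) ^ (β / 2))‖
      = 2 * α * (2 / ((n : ℝ) + 1)) ^ (β / 2) := by
    intro n
    have h : (2 : ℝ) ^ (n + 1) / (n + 1)! = (2 / ((n : ℝ) + 1)) * ((2 : ℝ) ^ n / n !) := by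
      rw [Nat.factorial_succ, pow_succ]
      push_cast
      field_simp
    have hp : (0 : ℝ) < ((2 : ℝ) ^ n / n !) ^ (β / 2) := by positivity
    rw [Real.norm_of_nonneg (by positivity), Real.norm_of_nonneg (by positivity), h,
      Real.mul_rpow (by positivity) (by positivity)]
    field_simp
    ring
  simp only [hratio]
  have h1 : Filter.Tendsto (fun n : ℕ => (2 : ℝ) / ((n : ℝ) + 1)) Filter.atTop (nhds 0) := by
    have := (tendsto_one_div_add_atTop_nhds_zero_nat (𝕜 := ℝ)).const_mul 2
    simpa only [mul_zero, mul_one_div] using this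
  have h2 := (h1.rpow_const (p := β / 2) (Or.inr (by positivity))).const_mul (2 * α)
  rwa [Real.zero_rpow (by positivity), mul_zero] at h2

/-- The unnormalized mass as an extended non-negative real. -/
noncomputable def eweight (α β : ℝ) (μ : YoungDiagram) : ℝ≥0∞ := ENNReal.ofReal (weight α β μ)

theorem eweight_eq {α β : ℝ} (hα : 0 < α) (hβ : 0 < β) (μ : YoungDiagram) :
    eweight α β μ
      = ENNReal.ofReal α ^ μ.card * ((numSYT μ : ℝ≥0∞) / (μ.card ! : ℝ≥0∞)) ^ β := by
  rw [eweight, weight, ENNReal.ofReal_mul (by positivity), ENNReal.ofReal_pow hα.le,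
    ← ENNReal.ofReal_rpow_of_nonneg (by positivity) hβ.le,
    ENNReal.ofReal_div_of_pos (by positivity), ENNReal.ofReal_natCast, ENNReal.ofReal_natCast]

theorem mixingWeight_eq {α β : ℝ} (hα : 0 < α) (hβ : 0 < β) (n : ℕ) :
    mixingWeight α β n = ∑' p : Partitions n, eweight α β p.1 := by
  rw [mixingWeight, ← ENNReal.tsum_mul_left]
  refine tsum_congr fun p => ?_
  rw [eweight_eq hα hβ, p.2]

theorem tsum_partitions (f : YoungDiagram → ℝ≥0∞) :
    ∑' n : ℕ, ∑' p : Partitions n, f p.1 = ∑' μ, f μ := by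
  rw [← (Equiv.sigmaFiberEquiv YoungDiagram.card).tsum_eq f, ENNReal.tsum_sigma']
  rfl

theorem mixingZ_eq {α β : ℝ} (hα : 0 < α) (hβ : 0 < β) :
    mixingZ α β = ∑' μ, eweight α β μ := by
  rw [mixingZ, ← tsum_partitions]
  exact tsum_congr fun n => mixingWeight_eq hα hβ n

theorem mixingZ_ne_top {α β : ℝ} (hα : 0 < α) (hβ : 0 < β) : mixingZ α β ≠ ∞ := by
  refine ne_top_of_le_ne_top (summable_weight_bound hα hβ).tsum_ofReal_ne_top ?_
  rw [mixingZ]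
  refine ENNReal.tsum_le_tsum fun n => ?_
  have := Fintype.ofFinite (Partitions n)
  rw [mixingWeight_eq hα hβ, tsum_fintype, ENNReal.ofReal_mul (by positivity)]
  refine (Finset.sum_le_card_nsmul _ _
    (ENNReal.ofReal (α ^ n * ((2 : ℝ) ^ n / n !) ^ (β / 2))) fun p _ => ?_).trans ?_
  · refine ENNReal.ofReal_le_ofReal ?_
    have := weight_le hα hβ p.1
    rwa [p.2] at this
  · rw [nsmul_eq_mul]
    gcongr
    rw [← ENNReal.ofReal_natCast]
    refine ENNReal.ofReal_le_ofReal ?_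
    have := card_partitions_le n
    rw [Nat.card_eq_fintype_card] at this
    exact_mod_cast this

theorem eweight_ne_zero {α : ℝ} (hα : 0 < α) (β : ℝ) (μ : YoungDiagram) : eweight α β μ ≠ 0 :=
  (ENNReal.ofReal_pos.2 (weight_pos hα β μ)).ne'

theorem mixingZ_ne_zero {α β : ℝ} (hα : 0 < α) (hβ : 0 < β) : mixingZ α β ≠ 0 := by
  rw [mixingZ_eq hα hβ]
  exact fun h => eweight_ne_zero hα β ⊥ (ENNReal.tsum_eq_zero.1 h ⊥)

/-! ### The mixture and the law of a row length -/

/-- The mass of a partition in the mixture is proportional to its weight: the sums over `Λ_n` in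
the two stages of the sampling cancel. -/
theorem mixingWeight_mul_betaPlancherel {α β : ℝ} (hα : 0 < α) (hβ : 0 < β) {n : ℕ}
    (p : Partitions n) :
    mixingWeight α β n *
      ((numSYT p.1 : ℝ≥0∞) ^ β / ∑' τ : Partitions n, (numSYT τ.1 : ℝ≥0∞) ^ β)
      = eweight α β p.1 := by
  set D : ℝ≥0∞ := ∑' τ : Partitions n, (numSYT τ.1 : ℝ≥0∞) ^ β with hD
  have hD0 : D ≠ 0 := by
    intro h
    have h1 := ENNReal.tsum_eq_zero.1 h p
    rw [ENNReal.rpow_eq_zero_iff_of_pos hβ] at h1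
    exact (numSYT_pos p.1).ne' (by exact_mod_cast h1)
  have hDtop : D ≠ ∞ := by
    have := Fintype.ofFinite (Partitions n)
    rw [hD, tsum_fintype]
    exact ENNReal.sum_ne_top.2 fun τ _ =>
      ENNReal.rpow_ne_top_of_nonneg hβ.le (ENNReal.natCast_ne_top _)
  have h : ∑' q : Partitions n, ((numSYT q.1 : ℝ≥0∞) / (n ! : ℝ≥0∞)) ^ β
      = D * ((n ! : ℝ≥0∞) ^ β)⁻¹ := by
    rw [hD, ← ENNReal.tsum_mul_right]
    exact tsum_congr fun q => by rw [ENNReal.div_rpow_of_nonneg _ _ hβ.le, div_eq_mul_inv]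
  rw [mixingWeight, h, eweight_eq hα hβ, p.2, ENNReal.div_rpow_of_nonneg _ _ hβ.le,
    div_eq_mul_inv, div_eq_mul_inv]
  calc ENNReal.ofReal α ^ n * (D * ((n ! : ℝ≥0∞) ^ β)⁻¹) * ((numSYT p.1 : ℝ≥0∞) ^ β * D⁻¹)
      = ENNReal.ofReal α ^ n * ((numSYT p.1 : ℝ≥0∞) ^ β * ((n ! : ℝ≥0∞) ^ β)⁻¹) * (D * D⁻¹) := by
        ring
    _ = _ := by rw [ENNReal.mul_inv_cancel hD0 hDtop, mul_one]

theorem mixture_apply {α β : ℝ} (hα : 0 < α) (hβ : 0 < β) (s : Set YoungDiagram) :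
    mixture α β s = (∑' μ, s.indicator (eweight α β) μ) / mixingZ α β := by
  have hs : MeasurableSet s := trivial
  rw [mixture, Measure.bind_apply hs (measurable_of_countable _).aemeasurable, mixing,
    lintegral_sum_measure, ← tsum_partitions, div_eq_mul_inv, ← ENNReal.tsum_mul_right]
  refine tsum_congr fun n => ?_
  rw [lintegral_smul_measure, lintegral_dirac, smul_eq_mul, betaPlancherel,
    Measure.sum_apply _ hs, ← ENNReal.tsum_mul_left, ← ENNReal.tsum_mul_right]
  refine tsum_congr fun p => ?_
  rw [Measure.smul_apply, Measure.dirac_apply' _ hs, smul_eq_mul]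
  by_cases hp : p.1 ∈ s
  · rw [Set.indicator_of_mem hp, Set.indicator_of_mem hp, Pi.one_apply, mul_one,
      ← mixingWeight_mul_betaPlancherel hα hβ p, div_eq_mul_inv]
    ring
  · rw [Set.indicator_of_notMem hp, Set.indicator_of_notMem hp, mul_zero, mul_zero, zero_mul]

theorem isProbabilityMeasure_mixture {α β : ℝ} (hα : 0 < α) (hβ : 0 < β) :
    IsProbabilityMeasure (mixture α β) := by
  refine ⟨?_⟩
  rw [mixture_apply hα hβ, Set.indicator_univ, ← mixingZ_eq hα hβ]
  exact ENNReal.div_self (mixingZ_ne_zero hα hβ) (mixingZ_ne_top hα hβ)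

theorem tsum_indicator_mul_le {α β : ℝ} (hα : 0 < α) (hβ : 0 < β) (i : ℕ) (k : ℤ) :
    (∑' μ, (rowLength i ⁻¹' {k - 1}).indicator (eweight α β) μ) *
        ∑' μ, (rowLength i ⁻¹' {k + 1}).indicator (eweight α β) μ
      ≤ (∑' μ, (rowLength i ⁻¹' {k}).indicator (eweight α β) μ) ^ 2 := by
  classical
  have hfin : ∀ (l : ℤ) (A : Finset YoungDiagram),
      ∑ μ ∈ A, (rowLength i ⁻¹' {l}).indicator (eweight α β) μ
        = ENNReal.ofReal (∑ μ ∈ A with rowLength i μ = l, weight α β μ) := by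
    intro l A
    rw [ENNReal.ofReal_sum_of_nonneg fun μ _ => (weight_pos hα β μ).le, Finset.sum_filter]
    refine Finset.sum_congr rfl fun μ _ => ?_
    simp only [Set.indicator_apply, Set.mem_preimage, Set.mem_singleton_iff, eweight]
  have hle : ∀ D : Finset YoungDiagram, (∀ μ ∈ D, (μ.rowLen (i - 1) : ℤ) = k) →
      ENNReal.ofReal (∑ μ ∈ D, weight α β μ)
        ≤ ∑' μ, (rowLength i ⁻¹' {k}).indicator (eweight α β) μ := by
    intro D hD
    rw [ENNReal.ofReal_sum_of_nonneg fun μ _ => (weight_pos hα β μ).le]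
    refine le_trans (le_of_eq (Finset.sum_congr rfl fun μ hμ => ?_)) (ENNReal.sum_le_tsum D)
    have hmem : μ ∈ rowLength i ⁻¹' {k} := hD μ hμ
    rw [Set.indicator_of_mem hmem]
    rfl
  have hnn : ∀ D : Finset YoungDiagram, 0 ≤ ∑ μ ∈ D, weight α β μ := fun D =>
    Finset.sum_nonneg fun μ _ => (weight_pos hα β μ).le
  rw [ENNReal.tsum_eq_iSup_sum (f := (rowLength i ⁻¹' {k - 1}).indicator (eweight α β)),
    ENNReal.tsum_eq_iSup_sum (f := (rowLength i ⁻¹' {k + 1}).indicator (eweight α β)),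
    ENNReal.iSup_mul]
  refine iSup_le fun B => ?_
  rw [ENNReal.mul_iSup]
  refine iSup_le fun A => ?_
  obtain ⟨D, E, hD, hE, h⟩ := sum_weight_mul_sum_le hα hβ (i - 1) k
    (A.filter fun μ => rowLength i μ = k + 1) (B.filter fun μ => rowLength i μ = k - 1)
    (fun μ hμ => (Finset.mem_filter.1 hμ).2) (fun μ hμ => (Finset.mem_filter.1 hμ).2)
  rw [hfin, hfin, mul_comm, ← ENNReal.ofReal_mul (hnn _), sq]
  refine (ENNReal.ofReal_le_ofReal h).trans ?_
  rw [ENNReal.ofReal_mul (hnn _)]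
  exact mul_le_mul' (hle D hD) (hle E hE)

theorem mixture_rowLength_ne_zero {α β : ℝ} (hα : 0 < α) (hβ : 0 < β) {i : ℕ} (hi : 1 ≤ i)
    {k : ℤ} (hk : 0 ≤ k) : mixture α β (rowLength i ⁻¹' {k}) ≠ 0 := by
  obtain ⟨m, rfl⟩ := Int.eq_ofNat_of_zero_le hk
  obtain ⟨μ, hμ⟩ := exists_rowLen_eq (f := fun j => if j < i then m else 0) (N := i)
    (fun a b hab => by dsimp only; split_ifs <;> omega) (by simp)
  have hmem : μ ∈ rowLength i ⁻¹' {(m : ℤ)} := by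
    rw [Set.mem_preimage, Set.mem_singleton_iff, rowLength, hμ, if_pos (by omega)]
  rw [mixture_apply hα hβ]
  refine (ENNReal.div_pos (fun h => ?_) (mixingZ_ne_top hα hβ)).ne'
  have h1 := ENNReal.tsum_eq_zero.1 h μ
  rw [Set.indicator_of_mem hmem] at h1
  exact eweight_ne_zero hα β μ h1

end BetaPlancherel

open BetaPlancherel

/-- For all `i ≥ 1` and `α, β > 0`, the mixture `M^{(α,β)}` is a probability measure (the constant
`Z_{α,β}` is finite) and the law of `λ_i` under it is log-concave. -/
theorem theorem1 (i : ℕ) (hi : 1 ≤ i) (α β : ℝ) (hα : 0 < α) (hβ : 0 < β) :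
    IsProbabilityMeasure (BetaPlancherel.mixture α β) ∧
      BetaPlancherel.IsLogConcaveLaw
        ((BetaPlancherel.mixture α β).map (BetaPlancherel.rowLength i)) := by
  have hprob := isProbabilityMeasure_mixture hα hβ
  have hmeas : Measurable (rowLength i) := fun _ _ => trivial
  have hmap : ∀ k : ℤ, ((mixture α β).map (rowLength i)).real {k}
      = (mixture α β (rowLength i ⁻¹' {k})).toReal := fun k => by
    rw [Measure.real, Measure.map_apply hmeas (measurableSet_singleton k)]
  refine ⟨hprob, Measure.isProbabilityMeasure_map hmeas.aemeasurable, fun k => measureReal_nonneg,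
    fun k => ?_, fun j k l hjk _ hj _ => ?_⟩
  · simp only [hmap]
    rw [← ENNReal.toReal_mul, ← ENNReal.toReal_pow]
    refine ENNReal.toReal_mono (ENNReal.pow_ne_top (measure_ne_top _ _)) ?_
    simp only [mixture_apply hα hβ, div_eq_mul_inv, mul_pow]
    rw [mul_mul_mul_comm, ← sq (mixingZ α β)⁻¹]
    gcongr
    exact tsum_indicator_mul_le hα hβ i k
  · simp only [hmap] at hj ⊢
    have hj0 : 0 ≤ j := by
      by_contra hneg
      refine hj ?_
      have hempty : rowLength i ⁻¹' {j} = ∅ := by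
        refine Set.eq_empty_of_forall_notMem fun μ (hμ : rowLength i μ = j) => ?_
        rw [rowLength] at hμ
        omega
      rw [hempty, measure_empty, ENNReal.toReal_zero]
    exact (ENNReal.toReal_pos (mixture_rowLength_ne_zero hα hβ hi (hj0.trans hjk.le))
      (measure_ne_top _ _)).ne'
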